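/- Let $S$ be a commutative ring (with $1$) and let $G$ be a finite group acting on $S$ by ring automorphisms. Let $R=S^G$ be the subring of invariants, and let $SG=S\#G$ be the skew group ring, that is, the free left $S$-module on $G$ with multiplication $(sg)(s'g')=s\,g(s')\,gg'$; let $\epsilon$ be the neutral element of $G$, regard $S$ as the subring $S\epsilon$ of $SG$, and put $f=\sum_{g\in G}g\in SG$. For an $S$-bimodule $M$ let $M^S=\{m\in M : sm=ms \text{ for all } s\in S\}$. Assume that $G$ acts infinitesimally through outer automorphisms on $S$, i.e. that the inclusion $S\to SG$, $s\mapsto s\epsilon$, induces a bijection $S=S^S\to (SG)^S$ (equivalently: for every $g\neq\epsilon$ and every $s'\neq 0$ in $S$ there is an $s\in S$ with $ss'-s'g(s)\neq 0$). The Noether different $\theta(S/R)\subseteq S$ is the image of $(S\otimes_R S)^S$ under the multiplication map $S\otimes_R S\to S$. The Morita defect is the quotient ring $\overline{SG}=SG/(SG)f(SG)=SG/SfS$. (a) The kernel of the composed ring homomorphism $S\to SG\to\overline{SG}$ contains $\theta(S/R)$; equivalently, $\theta(S/R)$ annihilates the $S$-bimodule $\overline{SG}$ from either side. (b) If $S$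 is noetherian, then $$\operatorname{grade}_{SG}\overline{SG}\ \ge\ \operatorname{depth}(\theta(S/R),S)\quad\text{in }\mathbb{N}\cup\{\infty\}.$$ Here $\operatorname{grade}_{SG}X=\inf\{i\ge 0 : \operatorname{Ext}^i_{SG}(X,SG)\neq 0\}$ for a right $SG$-module $X$, with $\operatorname{Ext}$ taken in the category of right $SG$-modules and $\inf\emptyset=\infty$; and $\operatorname{depth}(I,S)$ is the supremum of the lengths of $S$-regular sequences contained in the ideal $I$ if $I\neq S$, and $\infty$ if $I=S$. -/

import Mathlib

open scoped TensorProduct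

universe u v w

noncomputable section

/-! ### Grade and depth -/

/-- The right `A`-module `X`, as an object of the category `Mod A` of right `A`-modules, that is,
of unital left modules over the opposite ring. -/
abbrev rightModuleCat (A : Type w) [Ring A] (X : Type w) [AddCommGroup X] [Module Aᵐᵒᵖ X] :
    ModuleCat.{w} Aᵐᵒᵖ :=
  ModuleCat.of Aᵐᵒᵖ X

/-- The grade `inf {i ≥ 0 | Ext_A^i(X, A) ≠ 0} ∈ ℕ ∪ {∞}` of a right `A`-module `X`, where `Ext`
is taken in the category of right `A`-modules. -/
def moduleGrade (A : Type w) [Ring A] (X : Type w) [AddCommGroup X] [Module Aᵐᵒᵖ X] : ℕ∞ :=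
  ⨅ (i : ℕ) (_ : Nontrivial
    (CategoryTheory.Abelian.Ext (rightModuleCat A X) (rightModuleCat A A) i)), (i : ℕ∞)

open Classical in
/-- The depth of an ideal `I` on a module `M`: the largest length of an `M`-regular sequence
contained in `I` if `I M ≠ M`, and `∞` if `I M = M`. -/
def idealDepth {S : Type u} [CommRing S] (I : Ideal S) (M : Type v) [AddCommGroup M]
    [Module S M] : ℕ∞ :=
  if I • (⊤ : Submodule S M) = ⊤ then ⊤
  else ⨆ (rs : List S) (_ : (∀ r ∈ rs, r ∈ I) ∧ RingTheory.Sequence.IsRegular M rs),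
    (rs.length : ℕ∞)

/-! ### The Noether different -/

section NoetherDifferent

variable (R : Type u) (S : Type v) [CommRing R] [CommRing S] [Algebra R S]

/-- The `S`-invariants `(S ⊗_R S)^S = {m | s m = m s for all s ∈ S}` of the `S`-bimodule
`S ⊗_R S`, on which `S` acts from the left through the first factor and from the right through
the second factor. -/
def tensorInvariants : Submodule S (S ⊗[R] S) where
  carrier := {m | ∀ s : S, (s ⊗ₜ[R] (1 : S)) * m = m * ((1 : S) ⊗ₜ[R] s)}
  zero_mem' s := by simp
  add_mem' ha hb s := by rw [mul_add, add_mul, ha s, hb s]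
  smul_mem' c m hm s := by rw [mul_smul_comm, smul_mul_assoc, hm s]

/-- The Noether different `θ(S/R)`: the image of `(S ⊗_R S)^S` under the multiplication map
`S ⊗_R S → S`. -/
def noetherDifferent : Ideal S :=
  (tensorInvariants R S).map (Algebra.TensorProduct.lmul'' R (S := S)).toLinearMap

end NoetherDifferent

/-! ### The skew group ring and its Morita defect -/

/-- The group `G` acts infinitesimally through outer automorphisms on the ring `S`: the inclusion
`S → SG`, `s ↦ s ε`, induces a bijection from the centre `S^S` of `S` onto the `S`-invariants
`(SG)^S = {x | s x = x s for all s ∈ S}` of the skew group ring. -/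
def ActsInfinitesimallyOuter (G : Type v) [Group G] (S : Type u) [Ring S]
    [MulSemiringAction G S] : Prop :=
  Set.BijOn (fun s : S => (SkewMonoidAlgebra.singleOneRingHom s : SkewMonoidAlgebra S G))
    (Set.center S)
    {x : SkewMonoidAlgebra S G | ∀ s : S,
      SkewMonoidAlgebra.singleOneRingHom s * x = x * SkewMonoidAlgebra.singleOneRingHom s}

section MoritaDefect

variable (G : Type v) [Group G] [Fintype G] (S : Type u) [CommRing S] [MulSemiringAction G S]

/-- The element `f = ∑_{g ∈ G} g` of the skew group ring `SG`. -/
def groupSum : SkewMonoidAlgebra S G :=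
  ∑ g : G, SkewMonoidAlgebra.of S G g

/-- The two-sided ideal `(SG) f (SG) = S f S` of the skew group ring, generated by
`f = ∑_{g ∈ G} g`. -/
def defectIdeal : Ideal (SkewMonoidAlgebra S G) :=
  (TwoSidedIdeal.span {groupSum G S}).asIdeal

instance defectIdeal_isTwoSided : (defectIdeal G S).IsTwoSided :=
  inferInstanceAs ((TwoSidedIdeal.span {groupSum G S}).asIdeal).IsTwoSided

/-- The Morita defect `SG / SfS`, a quotient ring of the skew group ring `SG`. -/
abbrev MoritaDefect : Type (max u v) :=
  SkewMonoidAlgebra S G ⧸ defectIdeal G S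

/-- The Morita defect as a right module over `SG`, by multiplication from the right. -/
instance moritaDefectRightModule : Module (SkewMonoidAlgebra S G)ᵐᵒᵖ (MoritaDefect G S) :=
  Module.compHom _ (Ideal.Quotient.mk (defectIdeal G S)).op

/-- The composed ring homomorphism `S → SG → SG / SfS`. -/
def toMoritaDefect : S →+* MoritaDefect G S :=
  (Ideal.Quotient.mk (defectIdeal G S)).comp SkewMonoidAlgebra.singleOneRingHom

end MoritaDefect

end

/-! For (a), send `a ⊗ b` to `a f b ∈ SfS`. This map is one of bimodules, so it takes `(S ⊗_R S)^S`
into `(SG)^S`, which is `S` by outerness. The `ε`-coefficient of `a f b` is `ab`, hence each element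
of the Noether different lies in `SfS`. For (b), `SG` is a Frobenius extension of `S`: as a right
`SG`-module it is the coinduced module `Hom_S(SG, S)` (`skewToCoind_bijective`). By (a), a regular
sequence in the Noether different annihilates the Morita defect, so Rees' argument, run over
coinduced modules, kills `Ext` below its length (`subsingleton_ext_coind`). -/

noncomputable section

open CategoryTheory CategoryTheory.Abelian

/-! ### Vanishing of Ext into coinduced modules -/

namespace ModuleCat

variable {S : Type u} [CommRing S] {A : Type max u v} [Ring A] (f : S →+* A)

/-- Coextension of scalars `M ↦ Hom_S(A, M)` along `f : S →+* A`, between categories of modules in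
the universe of `A`. -/
abbrev coind : ModuleCat.{max u v} S ⥤ ModuleCat.{max u v} A :=
  coextendScalars.{u, max u v, max u v} f

instance coind_additive : (coind.{u, v} f).Additive where
  map_add := rfl

/-- A right adjoint is left exact, so only epimorphisms matter, and these lift because `A` is
projective over `S`. -/
lemma coind_preservesHomology [Module.Projective S ((restrictScalars f).obj (of A A))] :
    (coind.{u, v} f).PreservesHomology := by
  have : (coind.{u, v} f).PreservesEpimorphisms := by
    refine ⟨fun {M N} g hg => ?_⟩
    rw [epi_iff_surjective] at hg ⊢
    intro φ
    obtain ⟨ψ, hψ⟩ := Module.projective_lifting_property g.hom (CoextendScalars.equiv f N φ) hg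
    exact ⟨(CoextendScalars.equiv f M).symm ψ, CoextendScalars.ext hψ⟩
  have : (coind.{u, v} f).IsRightAdjoint := inferInstance
  exact Functor.preservesHomology_of_preservesEpis_and_kernels _

/-- The exact sequence `0 → coind M → coind N → coind P → 0` induced by a short exact sequence. -/
lemma coind_shortExact [Module.Projective S ((restrictScalars f).obj (of A A))]
    {T : ShortComplex (ModuleCat.{max u v} S)} (hT : T.ShortExact) :
    (T.map (coind.{u, v} f)).ShortExact := by
  have := coind_preservesHomology.{u, v} f
  have := hT.mono_f
  have := hT.epi_g
  exact hT.map _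

/-- If `f s` annihilates `X`, then multiplication by `s` on `M` induces zero on
`Hom(X, coind M)`. -/
lemma comp_coind_map_smul_eq_zero {X : ModuleCat.{max u v} A} {s : S}
    (hs : ∀ x : X, f s • x = 0) {M : ModuleCat.{max u v} S}
    (h : X ⟶ (coind.{u, v} f).obj M) : h ≫ (coind.{u, v} f).map (s • 𝟙 M) = 0 := by
  apply ((restrictCoextendScalarsAdj.{max u v, u, max u v} f).homEquiv _ _).symm.injective
  rw [Adjunction.homEquiv_naturality_right_symm]
  -- By adjunction the composite is `x ↦ s • k x = k (f s • x) = 0`.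
  have key (k : (restrictScalars f).obj X ⟶ M) : k ≫ (s • 𝟙 M) = 0 := by
    ext x
    exact (k.hom.map_smul s x).symm.trans ((congrArg k.hom (hs x)).trans (map_zero _))
  rw [key]
  symm
  exact ((restrictCoextendScalarsAdj.{max u v, u, max u v} f).homAddEquiv _ _).symm.map_zero

/-- If `f s` annihilates `X`, then multiplication by `s` on `M` induces zero on
`Ext^i(X, coind M)`. -/
lemma ext_comp_coind_map_smul_eq_zero [Module.Projective S ((restrictScalars f).obj (of A A))]
    {X : ModuleCat.{max u v} A} {s : S} (hs : ∀ x : X, f s • x = 0) (i : ℕ)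
    (M : ModuleCat.{max u v} S) (e : Ext X ((coind.{u, v} f).obj M) i) :
    e.comp (Ext.mk₀ ((coind.{u, v} f).map (s • 𝟙 M))) (add_zero i) = 0 := by
  induction i generalizing M with
  | zero =>
    obtain ⟨h, rfl⟩ := Ext.addEquiv₀.symm.surjective e
    rw [Ext.addEquiv₀_symm_apply, Ext.mk₀_comp_mk₀, comp_coind_map_smul_eq_zero f hs, Ext.mk₀_zero]
  | succ i ih =>
    -- Dimension shift: `coind` of an injective is injective, so `e` is the connecting image of a
    -- class one degree lower.
    let T := ShortComplex.mk _ _ (Limits.cokernel.condition (Injective.ι M))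
    have hT : T.ShortExact :=
      { exact := ShortComplex.exact_of_g_is_cokernel _ (Limits.cokernelIsCokernel T.f) }
    have hT' := coind_shortExact.{u, v} f hT
    have : Injective ((coind.{u, v} f).obj (Injective.under M)) :=
      (restrictCoextendScalarsAdj.{max u v, u, max u v} f).map_injective _ inferInstance
    have : Injective (T.map (coind.{u, v} f)).X₂ := this
    obtain ⟨e', rfl⟩ := Ext.covariant_sequence_exact₁ X hT' e (Ext.eq_zero_of_injective _) rfl
    let φ : T ⟶ T :=
      { τ₁ := s • 𝟙 _
        τ₂ := s • 𝟙 _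
        τ₃ := s • 𝟙 _ }
    let ψ : T.map (coind.{u, v} f) ⟶ T.map (coind.{u, v} f) := (coind.{u, v} f).mapShortComplex.map φ
    -- Naturality of the connecting map moves multiplication by `s` from `M` to the cokernel.
    refine (Ext.comp_assoc_of_third_deg_zero e' hT'.extClass (Ext.mk₀ ψ.τ₁) rfl).trans ?_
    rw [hT'.extClass_naturality hT' ψ, ← Ext.comp_assoc_of_second_deg_zero]
    exact (congrArg (fun z => Ext.comp z hT'.extClass rfl) (ih _ e')).trans (Ext.zero_comp ..)

open RingTheory.Sequence in
/-- If the ring homomorphism `f` makes `A` a projective module and `rs` is a weakly `M`-regular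
sequence whose image in `A` annihilates `X`, then `Ext^i(X, coind M) = 0` for `i < length rs`. -/
lemma subsingleton_ext_coind [Module.Projective S ((restrictScalars f).obj (of A A))]
    {X : ModuleCat.{max u v} A} (rs : List S) (hrs : ∀ r ∈ rs, ∀ x : X, f r • x = 0)
    (M : ModuleCat.{max u v} S) (reg : IsWeaklyRegular M rs) (i : ℕ) (hi : i < rs.length) :
    Subsingleton (Ext X ((coind.{u, v} f).obj M) i) := by
  induction rs generalizing M i with
  | nil => simp at hi
  | cons r rs ih =>
    rw [isWeaklyRegular_cons_iff] at reg
    have hT := coind_shortExact.{u, v} f reg.1.smulShortComplex_shortExact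
    refine subsingleton_of_forall_eq 0 fun e => ?_
    -- Since `r` acts as zero, `e` comes from `coind (M/rM)` one degree lower, where induction
    -- applies; in degree 0, injectivity of `r` gives `e = 0`.
    have he := ext_comp_coind_map_smul_eq_zero.{u, v} f (hrs r (by simp)) i M e
    match i with
    | 0 =>
      have : Mono ((coind.{u, v} f).map (r • 𝟙 M)) := hT.mono_f
      exact (Ext.postcomp_mk₀_injective_of_mono X _) (he.trans (map_zero _).symm)
    | i + 1 =>
      obtain ⟨e', rfl⟩ := Ext.covariant_sequence_exact₁ X hT e he rfl
      have := ih (fun r' h' => hrs r' (by simp [h'])) (of S (QuotSMulTop r M)) reg.2 i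
        (by simpa using hi)
      have : Subsingleton (Ext X ((M.smulShortComplex r).map (coind.{u, v} f)).X₃ i) := this
      exact (congrArg (fun z => Ext.comp z hT.extClass rfl) (Subsingleton.elim e' 0)).trans
        (Ext.zero_comp ..)

end ModuleCat

/-! ### The Noether different lies in `SfS` -/

section NoetherDifferent

variable (G : Type v) [Group G] [Fintype G] (S : Type u) [CommRing S] [MulSemiringAction G S]

open SkewMonoidAlgebra

omit [Fintype G] in
@[simp]
lemma singleOneRingHom_apply (s : S) :
    (singleOneRingHom s : SkewMonoidAlgebra S G) = single 1 s := rfl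

lemma coeff_single_mul_groupSum_mul_single (a b : S) (g : G) :
    (single 1 a * groupSum G S * single 1 b).coeff g = a * g • b := by
  classical
  have h : (groupSum G S).coeff g = 1 := by
    have := map_sum ((Finsupp.applyAddHom g).comp (coeffAddEquiv (k := S) (G := G)).toAddMonoidHom)
      (fun x : G => of S G x) Finset.univ
    refine this.trans ?_
    simp [of_apply, coeffAddEquiv]
  simp [h]

/-- The map of bimodules `S ⊗_{S^G} S → SG`, `a ⊗ b ↦ a f b`. -/
def tensorToSkew : S ⊗[FixedPoints.subring S G] S →+ SkewMonoidAlgebra S G :=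
  TensorProduct.liftAddHom
    (AddMonoidHom.mk' (fun a => AddMonoidHom.mk'
        (fun b => single 1 a * groupSum G S * single 1 b)
        fun b b' => by rw [single_add, mul_add])
      fun a a' => by ext1 b; simp [single_add, add_mul])
    fun r a b => by
      -- Balancedness holds because invariants commute with `f`.
      refine SkewMonoidAlgebra.ext fun g => ?_
      have : g • (r : S) = r := r.2 g
      simp [Subring.smul_def, smul_mul', this, mul_left_comm,
        mul_assoc]

@[simp]
lemma tensorToSkew_tmul (a b : S) :
    tensorToSkew G S (a ⊗ₜ b) = single 1 a * groupSum G S * single 1 b := rfl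

variable {G S}

lemma tensorToSkew_mem_defectIdeal (t : S ⊗[FixedPoints.subring S G] S) :
    tensorToSkew G S t ∈ defectIdeal G S := by
  induction t with
  | zero => simp
  | add x y hx hy => rw [map_add]; exact add_mem hx hy
  | tmul a b =>
    have h : groupSum G S ∈ defectIdeal G S := TwoSidedIdeal.mem_asIdeal.2
      (TwoSidedIdeal.subset_span rfl)
    exact Ideal.mul_mem_right _ _ (Ideal.mul_mem_left _ _ h)

lemma coeff_tensorToSkew_one (t : S ⊗[FixedPoints.subring S G] S) :
    (tensorToSkew G S t).coeff 1 = Algebra.TensorProduct.lmul'' (FixedPoints.subring S G) t := by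
  induction t with
  | zero => simp
  | add x y hx hy => simp [hx, hy]
  | tmul a b => 
    simp only [tensorToSkew_tmul, coeff_single_mul_groupSum_mul_single, one_smul]
    rfl

lemma tensorToSkew_tmul_one_mul (s : S) (t : S ⊗[FixedPoints.subring S G] S) :
    tensorToSkew G S ((s ⊗ₜ 1) * t) = single 1 s * tensorToSkew G S t := by
  induction t with
  | zero => simp
  | add x y hx hy => simp [mul_add, hx, hy]
  | tmul a b =>
    have : (single 1 (s * a) : SkewMonoidAlgebra S G) = single 1 s * single 1 a := by simp
    rw [Algebra.TensorProduct.tmul_mul_tmul, one_mul, tensorToSkew_tmul, tensorToSkew_tmul, this,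
      mul_assoc, mul_assoc, mul_assoc]

lemma tensorToSkew_mul_one_tmul (s : S) (t : S ⊗[FixedPoints.subring S G] S) :
    tensorToSkew G S (t * (1 ⊗ₜ s)) = tensorToSkew G S t * single 1 s := by
  induction t with
  | zero => simp
  | add x y hx hy => simp [add_mul, hx, hy]
  | tmul a b =>
    have : (single 1 (b * s) : SkewMonoidAlgebra S G) = single 1 b * single 1 s := by simp
    rw [Algebra.TensorProduct.tmul_mul_tmul, mul_one, tensorToSkew_tmul, tensorToSkew_tmul, this,
      mul_assoc, mul_assoc, mul_assoc]

/-- The Noether different is contained in the kernel of `S → SG / SfS`. -/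
theorem noetherDifferent_le_ker (hG : ActsInfinitesimallyOuter G S) :
    noetherDifferent (FixedPoints.subring S G) S ≤ RingHom.ker (toMoritaDefect G S) := by
  rintro _ ⟨t, ht, rfl⟩
  have hmem : tensorToSkew G S t ∈ {x : SkewMonoidAlgebra S G | ∀ s : S,
      singleOneRingHom s * x = x * singleOneRingHom s} := fun s => by
    simp only [singleOneRingHom_apply, ← tensorToSkew_tmul_one_mul, ← tensorToSkew_mul_one_tmul,
      ht s]
  -- Outerness forces the image of `t` to be `c ε`; its `ε`-coefficient then identifies `c`.
  obtain ⟨c, -, hc⟩ := hG.surjOn hmem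
  have h1 : Algebra.TensorProduct.lmul'' (FixedPoints.subring S G) t = c := by
    rw [← coeff_tensorToSkew_one, ← hc]
    simp
  have h2 := tensorToSkew_mem_defectIdeal t
  rw [← hc] at h2
  rw [RingHom.mem_ker]
  refine Ideal.Quotient.eq_zero_iff_mem.2 ?_
  convert h2
  exact h1

end NoetherDifferent

/-! ### `SG` as a coinduced module -/

section Coinduced

variable (G : Type v) [Group G] [Fintype G] (S : Type u) [CommRing S] [MulSemiringAction G S]

open SkewMonoidAlgebra

/-- The inclusion of `S` into the opposite of the skew group ring: restriction of scalars along it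
is the restriction of right `SG`-modules to `S`. -/
def toSkewOp : S →+* (SkewMonoidAlgebra S G)ᵐᵒᵖ where
  toFun s := .op (single 1 s)
  map_one' := rfl
  map_zero' := by simp
  map_add' a b := by simp [single_add]
  map_mul' a b := by rw [mul_comm a b, ← MulOpposite.op_mul]; simp

/-- `SG` is free as a right `S`-module, with coordinates `∑ g s_g ↦ (s_g)_g`. -/
def rightCoordinates :
    (ModuleCat.restrictScalars (toSkewOp G S)).obj (.of _ (SkewMonoidAlgebra S G)ᵐᵒᵖ) ≃ₗ[S]
      (G → S) where
  -- Coefficients are stored on the left; the twist is `s g = g · g⁻¹(s)`.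
  toFun (x : (SkewMonoidAlgebra S G)ᵐᵒᵖ) g := g⁻¹ • x.unop.coeff g
  invFun c := MulOpposite.op (.ofCoeff (Finsupp.equivFunOnFinite.symm fun g => g • c g))
  map_add' (x y : (SkewMonoidAlgebra S G)ᵐᵒᵖ) := by
    ext g
    change g⁻¹ • (x.unop + y.unop).coeff g = g⁻¹ • x.unop.coeff g + g⁻¹ • y.unop.coeff g
    simp
  map_smul' s (x : (SkewMonoidAlgebra S G)ᵐᵒᵖ) := by
    ext g
    change g⁻¹ • (x.unop * single 1 s).coeff g = s * g⁻¹ • x.unop.coeff g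
    simp [mul_comm]
  left_inv (x : (SkewMonoidAlgebra S G)ᵐᵒᵖ) := by
    refine MulOpposite.unop_injective (SkewMonoidAlgebra.ext fun g => ?_)
    simp
  right_inv c := by ext g; simp

instance projective_skewOp : Module.Projective S
    ((ModuleCat.restrictScalars (toSkewOp G S)).obj (.of _ (SkewMonoidAlgebra S G)ᵐᵒᵖ)) :=
  .of_equiv (rightCoordinates G S).symm

end Coinduced

section Coinduced

variable (G : Type v) [Group G] [Fintype G] (S : Type u) [CommRing S] [MulSemiringAction G S]

open SkewMonoidAlgebra ModuleCat

omit [Fintype G] in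
variable {G S} in
/-- Linear maps on the right `S`-module `SG` are determined by their values on `G`. -/
lemma linearMap_ext_single {N : Type w} [AddCommGroup N] [Module S N]
    {φ ψ : (restrictScalars (toSkewOp G S)).obj (of _ (SkewMonoidAlgebra S G)ᵐᵒᵖ) →ₗ[S] N}
    (h : ∀ g : G, φ (.op (single g 1) : (SkewMonoidAlgebra S G)ᵐᵒᵖ) =
      ψ (.op (single g 1) : (SkewMonoidAlgebra S G)ᵐᵒᵖ)) : φ = ψ := by
  refine LinearMap.ext fun (b : (SkewMonoidAlgebra S G)ᵐᵒᵖ) => ?_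
  obtain ⟨b, rfl⟩ := MulOpposite.op_surjective b
  induction b using SkewMonoidAlgebra.induction_on with
  | zero => exact (map_zero φ).trans (map_zero ψ).symm
  | single g s =>
    have hs : (MulOpposite.op (single g s) : (SkewMonoidAlgebra S G)ᵐᵒᵖ) =
        toSkewOp G S (g⁻¹ • s) * .op (single g 1) := by simp [toSkewOp, ← MulOpposite.op_mul]
    rw [hs]
    exact (φ.map_smul _ _).trans ((congrArg _ (h g)).trans (ψ.map_smul _ _).symm)
  | add b b' hb hb' =>
    exact (φ.map_add _ _).trans ((congrArg₂ _ hb hb').trans (ψ.map_add _ _).symm)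

/-- The linear form `x ↦ x_ε` on the right `S`-module `SG`. -/
def coeffOne :
    (restrictScalars (toSkewOp G S)).obj (of _ (SkewMonoidAlgebra S G)ᵐᵒᵖ) →ₗ[S]
      ULift.{v} S where
  toFun (x : (SkewMonoidAlgebra S G)ᵐᵒᵖ) := ⟨x.unop.coeff 1⟩
  map_add' (x y : (SkewMonoidAlgebra S G)ᵐᵒᵖ) := by
    change ULift.up ((x.unop + y.unop).coeff 1) = ⟨x.unop.coeff 1 + y.unop.coeff 1⟩
    simp
  map_smul' s (x : (SkewMonoidAlgebra S G)ᵐᵒᵖ) := by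
    change ULift.up ((x.unop * single 1 s).coeff 1) = ⟨s * x.unop.coeff 1⟩
    simp [mul_comm]

/-- The right `SG`-linear map `SG → Hom_S(SG, S)`, `a ↦ (b ↦ (ab)_ε)`. -/
def skewToCoind :
    SkewMonoidAlgebra S G →ₗ[(SkewMonoidAlgebra S G)ᵐᵒᵖ]
      (coind.{u, v} (toSkewOp G S)).obj (of S (ULift.{v} S)) where
  toFun a := (.op a : (SkewMonoidAlgebra S G)ᵐᵒᵖ) •
    (CoextendScalars.equiv (toSkewOp G S) (of S (ULift.{v} S))).symm (coeffOne G S)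
  map_add' a b := by rw [MulOpposite.op_add, add_smul]
  map_smul' c a := by
    rw [RingHom.id_apply, smul_smul]
    rfl

omit [Fintype G] in
lemma skewToCoind_apply (a b : SkewMonoidAlgebra S G) :
    CoextendScalars.equiv (toSkewOp G S) (of S (ULift.{v} S)) (skewToCoind G S a) (.op b) =
      ULift.up ((a * b).coeff 1) :=
  rfl

/-- The pairing `(ab)_ε` is perfect because `(a g⁻¹)_ε = a_g`: values on `G` recover all
coefficients of `a` and can be prescribed freely. -/
lemma skewToCoind_bijective : Function.Bijective (skewToCoind G S) := by
  constructor
  · intro a a' h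
    refine SkewMonoidAlgebra.ext fun g => ?_
    have := congrArg (fun φ => CoextendScalars.equiv (toSkewOp G S) (of S (ULift.{v} S)) φ
      (.op (single g⁻¹ 1))) h
    simpa using ULift.up_injective this
  · intro φ
    set ψ := CoextendScalars.equiv (toSkewOp G S) (of S (ULift.{v} S)) φ with hψ
    refine ⟨.ofCoeff (Finsupp.equivFunOnFinite.symm fun g => (ψ (.op (single g⁻¹ 1))).down), ?_⟩
    refine CoextendScalars.ext (linearMap_ext_single fun g => ?_)
    rw [← hψ, skewToCoind_apply]
    simp

end Coinduced

/-! ### The grade bound -/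

section

variable (G : Type v) [Group G] [Fintype G] (S : Type u) [CommRing S] [MulSemiringAction G S]
open ModuleCat

lemma toSkewOp_smul_moritaDefect (s : S) (x : MoritaDefect G S) :
    toSkewOp G S s • x = x * toMoritaDefect G S s :=
  rfl

/-- A weakly regular sequence in the kernel of `S → SG / SfS` bounds the grade of the Morita
defect from below. -/
lemma length_le_moduleGrade (rs : List S) (hrs : ∀ r ∈ rs, toMoritaDefect G S r = 0)
    (reg : RingTheory.Sequence.IsWeaklyRegular S rs) :
    (rs.length : ℕ∞) ≤ moduleGrade (SkewMonoidAlgebra S G) (MoritaDefect G S) := by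
  refine le_iInf₂ fun i hi => ?_
  by_contra hlt
  rw [Nat.cast_le, not_le] at hlt
  have reg' : RingTheory.Sequence.IsWeaklyRegular (of S (ULift.{v} S)) rs :=
    (ULift.moduleEquiv (R := S) (M := S)).symm.isWeaklyRegular_congr rs |>.1 reg
  have := subsingleton_ext_coind.{u, v} (toSkewOp G S)
    (X := rightModuleCat (SkewMonoidAlgebra S G) (MoritaDefect G S)) rs
    (fun r hr x => (toSkewOp_smul_moritaDefect G S r x).trans (by rw [hrs r hr, mul_zero]))
    (of S (ULift.{v} S)) reg' i hlt
  let e : rightModuleCat (SkewMonoidAlgebra S G) (SkewMonoidAlgebra S G) ≅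
      (coind.{u, v} (toSkewOp G S)).obj (of S (ULift.{v} S)) :=
    (LinearEquiv.ofBijective _ (skewToCoind_bijective G S)).toModuleIso
  have : Subsingleton (Ext (rightModuleCat _ (MoritaDefect G S))
      (rightModuleCat (SkewMonoidAlgebra S G) (SkewMonoidAlgebra S G)) i) := by
    refine subsingleton_of_forall_eq 0 fun x => ?_
    -- The vanishing is transported along `SG ≅ Hom_S(SG, S)`.
    rw [← Ext.comp_mk₀_id x, ← e.hom_inv_id, ← Ext.mk₀_comp_mk₀,
      ← Ext.comp_assoc_of_second_deg_zero, Subsingleton.elim (x.comp (Ext.mk₀ e.hom) _) 0,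
      Ext.zero_comp]
  exact not_subsingleton _ this

end

/-- The zero module has infinite grade. -/
lemma moduleGrade_eq_top_of_subsingleton (A : Type w) [Ring A] (X : Type w) [AddCommGroup X]
    [Module Aᵐᵒᵖ X] [Subsingleton X] : moduleGrade A X = ⊤ := by
  refine iInf₂_eq_top.2 fun i hi => absurd hi ?_
  rw [not_nontrivial_iff_subsingleton]
  refine subsingleton_of_forall_eq 0 fun x => ?_
  rw [← Ext.mk₀_id_comp x,
    (ModuleCat.isZero_of_subsingleton (rightModuleCat A X)).eq_of_src (𝟙 _) 0, Ext.mk₀_zero,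
    Ext.zero_comp]

end

theorem corollary7 (G : Type v) [Group G] [Fintype G] (S : Type u) [CommRing S]
    [MulSemiringAction G S] (hG : ActsInfinitesimallyOuter G S) :
    (noetherDifferent (FixedPoints.subring S G) S ≤ RingHom.ker (toMoritaDefect G S) ∧
      ∀ s ∈ noetherDifferent (FixedPoints.subring S G) S, ∀ x : MoritaDefect G S,
        toMoritaDefect G S s * x = 0 ∧ x * toMoritaDefect G S s = 0) ∧
    (IsNoetherianRing S →
      idealDepth (noetherDifferent (FixedPoints.subring S G) S) S ≤
        moduleGrade (SkewMonoidAlgebra S G) (MoritaDefect G S)) := by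
  have hker := noetherDifferent_le_ker hG
  refine ⟨⟨hker, fun s hs x => ?_⟩, fun _ => ?_⟩
  · rw [RingHom.mem_ker.1 (hker hs), zero_mul, mul_zero]
    exact ⟨rfl, rfl⟩
  · rw [idealDepth]
    split_ifs with h
    -- If the Noether different is all of `S`, then `1 = 0` in the Morita defect, and both sides are
    -- infinite.
    · rw [smul_eq_mul, Ideal.mul_top] at h
      have h1 : toMoritaDefect G S 1 = 0 := hker (h ▸ Submodule.mem_top)
      rw [map_one] at h1
      have := subsingleton_of_zero_eq_one h1.symm
      rw [moduleGrade_eq_top_of_subsingleton]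
    · exact iSup₂_le fun rs hrs =>
        length_le_moduleGrade G S rs (fun r hr => hker (hrs.1 r hr)) hrs.2.toIsWeaklyRegular
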